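/- Let $X$ be a smooth projective variety over an algebraically closed field $\kappa$, with an ample line bundle $\mathcal O_X(1)$. For a coherent sheaf $E$ on $X$ let $P_E\in\mathbb Q[t]$ be its Hilbert polynomial, $P_E(m)=\chi(X,E\otimes\mathcal O_X(m))$, and $\operatorname{rk}(E)$ its rank, i.e. the dimension of its generic stalk over the function field of $X$; polynomials in $\mathbb Q[t]$ are compared lexicographically, starting from the highest degree. Let $\delta\in\mathbb Q[t]$ have positive leading coefficient. For a pair $(E,s)$ consisting of a coherent sheaf $E$ of positive rank and a section $s\in H^0(X,E)$ put $p^\delta_{(E,s)}=\frac{P_E+\epsilon\,\delta}{\operatorname{rk}(E)}$, where $\epsilon=1$ if $s\neq0$ and $\epsilon=0$ if $s=0$. A sub-pair of $(E,s)$ is a pair $(F,s')$ with $\iota: F\hookrightarrow E$ a coherent subsheaf and $\iota(s')\in\kappa\cdot s$ (so $s'=0$ is allowed). For $E$ torsion-free, $(E,s)$ is called $\delta$-stable if $s\ne0$ and $p^\delta_{(F,s')}<p^\delta_{(E,s)}$ for every sub-pair $(F,s')$ with $0\ne F\subsetneq E$; and $E$ is called Gieseker semistable if $P_F/\operatorname{rk}(F)\le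 P_E/\operatorname{rk}(E)$ for every coherent subsheaf $0\neq F\subsetneq E$. Let $E$ be a torsion-free coherent sheaf of rank $r\ge2$ on $X$ with $h^0(E)>0$, let $\delta<\frac1{r-1}$ (so that $\delta$ is a positive constant), and let $s\in H^0(X,E)$. If the pair $(E,s)$ is $\delta$-stable, then $E$ is Gieseker semistable. -/

import Mathlib

open CategoryTheory AlgebraicGeometry Polynomial

universe u

noncomputable section

namespace StablePair

/-! ### Lexicographic order on rational polynomials -/

/-- `P < Q` in the lexicographic order on `ℚ[t]`: at the largest degree in which the coefficients
of `P` and `Q` differ, the coefficient of `P` is the smaller one. -/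
def LexLT (P Q : ℚ[X]) : Prop :=
  ∃ n : ℕ, P.coeff n < Q.coeff n ∧ ∀ m : ℕ, n < m → P.coeff m = Q.coeff m

/-- `P ≤ Q` in the lexicographic order on `ℚ[t]`. -/
def LexLE (P Q : ℚ[X]) : Prop := LexLT P Q ∨ P = Q

/-! ### Sheaves of modules on a scheme -/

variable {X : Scheme.{u}}

/-- The structure sheaf `𝒪_X` as an `𝒪_X`-module. -/
def structureModule (X : Scheme.{u}) : X.Modules := SheafOfModules.unit X.ringCatSheaf

/-- Coherent sheaves, for a locally noetherian scheme: quasi-coherent and of finite type. -/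
structure IsCoherent (E : X.Modules) : Prop where
  quasicoherent : SheafOfModules.IsQuasicoherent (R := X.ringCatSheaf) E
  finiteType : SheafOfModules.IsFiniteType (R := X.ringCatSheaf) E

/-- A line bundle: an `𝒪_X`-module that is locally isomorphic to `𝒪_X`. -/
def IsLineBundle (L : X.Modules) : Prop :=
  ∀ x : X, ∃ U : X.Opens, x ∈ U ∧ Nonempty (L.restrict U.ι ≅ structureModule U.toScheme)

/-- The tensor product `E ⊗ L` over `𝒪_X`: the sheaf associated with
`U ↦ E(U) ⊗ L(U)` (tensor product over `𝒪_X(U)`). -/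
def tensor (E L : X.Modules) : X.Modules :=
  (PresheafOfModules.sheafification (𝟙 X.ringCatSheaf.obj)).obj
    (PresheafOfModules.Monoidal.tensorObj (R := X.presheaf) E.val L.val)

/-- The twist `E ⊗ L^{⊗ m}`; for `L = 𝒪_X(1)` this is `E(m)`. -/
def twist (L E : X.Modules) : ℕ → X.Modules
  | 0 => E
  | m + 1 => tensor (twist L E m) L

/-- `E` is generated by its global sections. -/
def IsGloballyGenerated (E : X.Modules) : Prop :=
  Nonempty (SheafOfModules.GeneratingSections (R := X.ringCatSheaf) E)

/-- An ample line bundle `L` on a noetherian scheme: for every coherent sheaf `F`, the sheaf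
`F ⊗ L^{⊗ m}` is globally generated for all large `m`. -/
structure IsAmple (L : X.Modules) : Prop where
  lineBundle : IsLineBundle L
  eventually_globallyGenerated : ∀ F : X.Modules, IsCoherent F →
    ∃ m₀ : ℕ, ∀ m : ℕ, m₀ ≤ m → IsGloballyGenerated (twist L F m)

/-- A torsion-free sheaf on an integral scheme: a nonzero function never kills a nonzero
section. -/
def IsTorsionFree (E : X.Modules) : Prop :=
  ∀ (U : X.Opens) (f : Γ(X, U)) (t : Γ(E, U)), f ≠ 0 → f • t = 0 → t = 0

/-- The `𝒪_{X,x}`-module structure on the stalk `E_x`. -/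
abbrev stalkModule (E : X.Modules) (x : X) :
    Module (X.presheaf.stalk x) (E.presheaf.stalk x) :=
  letI M : PresheafOfModules.{u} (X.presheaf ⋙ forget₂ CommRingCat RingCat) := E.val
  inferInstanceAs (Module (X.presheaf.stalk x) ↑(TopCat.Presheaf.stalk M.presheaf x))

/-- The rank of a coherent sheaf on an integral scheme, i.e. the rank of its restriction to a dense
open subset where it is locally free: the dimension of the stalk at the generic
point over the function field. -/
def rank [IsIntegral X] (E : X.Modules) : ℕ :=
  letI := stalkModule E (genericPoint X)
  Module.finrank X.functionField (E.presheaf.stalk (genericPoint X))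

/-- The support of a sheaf. -/
def support (E : X.Modules) : Set X := {x | Nontrivial (E.presheaf.stalk x)}

/-- A pure sheaf: every nonzero coherent subsheaf has support of the same dimension as `E`. -/
def IsPure (E : X.Modules) : Prop :=
  ∀ (F : X.Modules) (i : F ⟶ E), Mono i → IsCoherent F → ¬ Limits.IsZero F →
    topologicalKrullDim (support F) = topologicalKrullDim (support E)

/-! ### Cohomology and the Hilbert polynomial -/

section Cohomology

variable {k : Type u} [Field k] (π : X ⟶ Spec (.of k))

/-- The ring homomorphism `k → 𝒪_X(U)` of a scheme `X` over the field `k`. -/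
def scalar (U : X.Opens) : k →+* Γ(X, U) :=
  (X.presheaf.map (homOfLE (le_top : U ≤ ⊤)).op).hom.comp
    (π.appTop.hom.comp (Scheme.ΓSpecIso (.of k)).inv.hom)

/-- The sheaf of abelian groups underlying an `𝒪_X`-module. -/
def abSheaf (E : X.Modules) : Sheaf (Opens.grothendieckTopology X) AddCommGrpCat.{u} :=
  (SheafOfModules.toSheaf X.ringCatSheaf).obj E

/-- The restriction maps of `𝒪_X` are compatible with the structure morphism to `k`. -/
lemma map_scalar {U V : X.Opens} (i : U ⟶ V) (c : k) :
    X.presheaf.map i.op (scalar π V c) = scalar π U c := by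
  change (X.presheaf.map (homOfLE (le_top : V ≤ ⊤)).op ≫ X.presheaf.map i.op) _ = _
  rw [← X.presheaf.map_comp]
  rfl

/-- Multiplication by `c : k` on the sheaf of abelian groups underlying `E`. -/
def scalarEnd (E : X.Modules) (c : k) : abSheaf E ⟶ abSheaf E where
  hom :=
    { app U := AddCommGrpCat.ofHom
        (Module.toAddMonoidEnd Γ(X, U.unop) Γ(E, U.unop) (scalar π U.unop c))
      naturality U V i := by
        ext t
        let t' : Γ(E, U.unop) := t
        change (scalar π V.unop c) • (show Γ(E, V.unop) from E.presheaf.map i t') =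
          E.presheaf.map i ((scalar π U.unop c) • t')
        have h := Scheme.Modules.map_smul E i.unop (scalar π U.unop c) t'
        rw [map_scalar] at h
        exact h.symm }

lemma scalarEnd_one (E : X.Modules) : scalarEnd π E 1 = 𝟙 _ := by
  ext U t
  change scalar π U.unop 1 • (show Γ(E, U.unop) from t) = (show Γ(E, U.unop) from t)
  rw [map_one, one_smul]

lemma scalarEnd_mul (E : X.Modules) (a b : k) :
    scalarEnd π E (a * b) = scalarEnd π E b ≫ scalarEnd π E a := by
  ext U t
  change scalar π U.unop (a * b) • (show Γ(E, U.unop) from t) = scalar π U.unop a • scalar π U.unop b • (show Γ(E, U.unop) from t)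
  rw [map_mul, mul_smul]

lemma scalarEnd_add (E : X.Modules) (a b : k) :
    scalarEnd π E (a + b) = scalarEnd π E a + scalarEnd π E b := by
  ext U t
  change scalar π U.unop (a + b) • (show Γ(E, U.unop) from t) = scalar π U.unop a • (show Γ(E, U.unop) from t) +
    scalar π U.unop b • (show Γ(E, U.unop) from t)
  rw [map_add, add_smul]

lemma scalarEnd_zero (E : X.Modules) : scalarEnd π E 0 = 0 := by
  ext U t
  change scalar π U.unop 0 • (show Γ(E, U.unop) from t) = (0 : Γ(E, U.unop))
  rw [map_zero, zero_smul]

/-- The sheaf cohomology group `Hⁱ(X, E)`. -/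
abbrev Cohomology (E : X.Modules) (i : ℕ) : Type u := Sheaf.H (abSheaf E) i

/-- The `k`-vector space structure on `Hⁱ(X, E)`: a scalar acts by functoriality, through its
action on `E`. -/
abbrev cohomologyModule (E : X.Modules) (i : ℕ) : Module k (Cohomology E i) where
  smul c x := Sheaf.H.map (scalarEnd π E c) i x
  one_smul x := by
    change Sheaf.H.map (scalarEnd π E 1) i x = x
    rw [scalarEnd_one, Sheaf.H.map_id_apply]
  mul_smul a b x := by
    change Sheaf.H.map (scalarEnd π E (a * b)) i x =
      Sheaf.H.map (scalarEnd π E a) i (Sheaf.H.map (scalarEnd π E b) i x)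
    rw [scalarEnd_mul, Sheaf.H.map_comp_apply]
  smul_zero c := map_zero _
  smul_add c := map_add _
  add_smul a b x := by
    change Sheaf.H.map (scalarEnd π E (a + b)) i x = 
      Sheaf.H.map (scalarEnd π E a) i x + Sheaf.H.map (scalarEnd π E b) i x
    rw [scalarEnd_add, Sheaf.H.map_add_apply]
  zero_smul x := by
    change Sheaf.H.map (scalarEnd π E 0) i x = 0
    rw [scalarEnd_zero]
    have := Sheaf.H.map_add_apply (0 : abSheaf E ⟶ abSheaf E) 0 x
    simpa using this

/-- `hⁱ(X, E) = dim_k Hⁱ(X, E)`. -/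
def cohomologyDim (E : X.Modules) (i : ℕ) : ℕ :=
  letI := cohomologyModule π E i
  Module.finrank k (Cohomology E i)

/-- The Euler characteristic `χ(X, E) = ∑ᵢ (-1)ⁱ hⁱ(X, E)`. -/
def eulerChar (E : X.Modules) : ℤ := ∑ᶠ i : ℕ, (-1) ^ i * (cohomologyDim π E i : ℤ)

open Classical in
/-- The Hilbert polynomial of `E` with respect to `L = 𝒪_X(1)`: the polynomial `P_E` such that
`P_E(m) = χ(X, E(m))`. Such a polynomial is unique; it exists for `E` coherent on a projective
scheme, and the value is `0` if there is none. -/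
def sheafHilbertPoly (L E : X.Modules) : ℚ[X] :=
  if h : ∃ P : ℚ[X], ∀ m : ℕ, P.eval (m : ℚ) = eulerChar π (twist L E m) then h.choose else 0

/-- The reduced `δ`-Hilbert polynomial `(P_E + ε δ) / rk E` of a pair `(E, s)` with `E` of positive
rank, where `ε = 1` if `s ≠ 0` and `ε = 0` if `s = 0`. -/
def reducedHilbertPoly [IsIntegral X] (L : X.Modules) (δ : ℚ[X]) (E : X.Modules) (s : Γ(E, ⊤)) :
    ℚ[X] :=
  open Classical in
  C (1 / (rank E : ℚ)) * (sheafHilbertPoly π L E + if s = 0 then 0 else δ)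

/-- A map of pairs `(F, s') → (E, s)` over `i : F → E`: the section `s'` is sent to a scalar
multiple of `s`. If `i` is injective, this makes `(F, s')` a sub-pair of `(E, s)`; thus
up to a scalar either `s = i ∘ s'` or `s' = 0`. -/
def IsPairHom {F E : X.Modules} (i : F ⟶ E) (s' : Γ(F, ⊤)) (s : Γ(E, ⊤)) : Prop :=
  ∃ c : k, i.app ⊤ s' = scalar π ⊤ c • s

/-- `δ`-stability of a coherent pair `(E, s)`: the sheaf `E` is pure, `s` is nonzero, and every
proper nonzero sub-pair has strictly smaller reduced `δ`-Hilbert polynomial. -/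
structure IsDeltaStable [IsIntegral X] (L : X.Modules) (δ : ℚ[X]) (E : X.Modules)
    (s : Γ(E, ⊤)) : Prop where
  coherent : IsCoherent E
  pure : IsPure E
  section_ne_zero : s ≠ 0
  lt : ∀ (F : X.Modules) (i : F ⟶ E) (s' : Γ(F, ⊤)), IsCoherent F → Mono i →
    ¬ Limits.IsZero F → ¬ IsIso i → IsPairHom π i s' s →
    LexLT (reducedHilbertPoly π L δ F s') (reducedHilbertPoly π L δ E s)

/-- Gieseker semistability of a torsion-free sheaf `E`: it is coherent and pure, and every proper
nonzero coherent subsheaf `F` satisfies `P_F / rk F ≤ P_E / rk E`. -/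
structure IsSemistable [IsIntegral X] (L : X.Modules) (E : X.Modules) : Prop where
  coherent : IsCoherent E
  pure : IsPure E
  le : ∀ (F : X.Modules) (i : F ⟶ E), IsCoherent F → Mono i →
    ¬ Limits.IsZero F → ¬ IsIso i →
    LexLE (C (1 / (rank F : ℚ)) * sheafHilbertPoly π L F) (C (1 / (rank E : ℚ)) * sheafHilbertPoly π L E)

end Cohomology
end StablePair
end

namespace StablePair

/-! Apply stability to the sub-pair `(F, 0)`: with `a = rank F`, it gives `P_F / a < (P_E + d) / r`,
where `δ = d` is constant. If also `P_F / a > P_E / r`, the two reduced polynomials differ only by a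
constant in `(0, d / r)`. Constant terms of Hilbert polynomials are the integers `A = χ(F)` and `B =
χ(E)` (or the default `0`), so the integer `A r - B a` lies strictly between `0` and `d a`. For `a <
r` this is impossible since `d a ≤ d (r - 1) < 1`; for `a = r`, divide by `r` and use `d < 1`. This
is `lexLE_of_lexLT_add`. The bounds `0 < a ≤ r` come from generic stalks: `rank_le_of_mono` and,
through torsion-freeness, `rank_pos_of_mono`. -/

/-! ### Lexicographic order and the integrality argument -/

lemma lexLT_trichotomy (P Q : ℚ[X]) : LexLT P Q ∨ P = Q ∨ LexLT Q P := by
  by_cases h : P = Q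
  · exact .inr (.inl h)
  have hD : P - Q ≠ 0 := sub_ne_zero.mpr h
  have hm : ∀ m, (P - Q).natDegree < m → P.coeff m = Q.coeff m := fun m hm ↦ by
    have := coeff_eq_zero_of_natDegree_lt hm
    rwa [coeff_sub, sub_eq_zero] at this
  have hn : P.coeff (P - Q).natDegree ≠ Q.coeff (P - Q).natDegree := fun e ↦
    hD (leadingCoeff_eq_zero.mp (by rw [leadingCoeff, coeff_sub, e, sub_self]))
  rcases lt_or_gt_of_ne hn with h1 | h1
  · exact .inl ⟨_, h1, hm⟩
  · exact .inr (.inr ⟨_, h1, fun m h2 ↦ (hm m h2).symm⟩)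

/-- A polynomial with positive leading coefficient below a constant is a positive constant. -/
lemma exists_eq_C_of_lexLT {δ : ℚ[X]} {c : ℚ} (hpos : 0 < δ.leadingCoeff) (h : LexLT δ (C c)) :
    ∃ d : ℚ, δ = C d ∧ 0 < d ∧ d < c := by
  obtain ⟨n, hn, hm⟩ := h
  obtain rfl : n = 0 := by
    -- In positive degree `n`, the negative coefficient found there would be the leading one.
    by_contra h0
    rw [coeff_C, if_neg h0] at hn
    have hdeg : δ.natDegree = n := by
      refine natDegree_eq_of_le_of_coeff_ne_zero (natDegree_le_iff_coeff_eq_zero.mpr fun m h1 ↦ ?_)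
        hn.ne
      rw [hm m h1, coeff_C, if_neg (by lia)]
    rw [leadingCoeff, hdeg] at hpos
    exact hpos.not_gt hn
  have hδ : δ = C (δ.coeff 0) := by
    ext m
    rcases Nat.eq_zero_or_pos m with rfl | h1
    · simp
    · rw [hm m h1, coeff_C, coeff_C, if_neg h1.ne', if_neg h1.ne']
  refine ⟨_, hδ, ?_, by simpa using hn⟩
  rw [hδ] at hpos
  simpa using hpos

/-- Between `P` and `P + e`, with `e` constant, there are only the translates of `P` by constants
smaller than `e`. -/
lemma coeff_zero_lt_of_lexLT {P Q : ℚ[X]} {e : ℚ} (h : LexLT P Q) (h' : LexLT Q (P + C e)) :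
    P.coeff 0 < Q.coeff 0 ∧ Q.coeff 0 < P.coeff 0 + e := by
  obtain ⟨n, hn, hn'⟩ := h
  obtain ⟨m, hm, hm'⟩ := h'
  -- The bounds `P` and `P + C e` agree in positive degree, so both comparisons must be decided in
  -- degree `0`.
  have hc (j : ℕ) (hj : 0 < j) : (P + C e).coeff j = P.coeff j := by
    rw [coeff_add, coeff_C, if_neg hj.ne', add_zero]
  rcases Nat.eq_zero_or_pos m with rfl | h0
  · rcases Nat.eq_zero_or_pos n with rfl | h1
    · exact ⟨hn, by simpa using hm⟩
    · exact absurd (hm' n h1) (by rw [hc n h1]; exact hn.ne')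
  · rw [hc m h0] at hm
    rcases lt_trichotomy m n with h1 | rfl | h1
    · exact absurd (hm' n h1) (by rw [hc n (by lia)]; exact hn.ne')
    · exact absurd hn hm.not_gt
    · exact absurd (hn' m h1) hm.ne'

/-- If `p` and `q` have integral constant terms, no `p / a` with `a ≤ r` lies strictly between
`q / r` and `(q + d) / r` when `d < 1 / (r - 1)`. -/
lemma lexLE_of_lexLT_add {a r : ℕ} (ha : 0 < a) (har : a ≤ r) (hr : 2 ≤ r) {d : ℚ}
    (hd0 : 0 < d) (hd : d < 1 / ((r : ℚ) - 1)) {p q : ℚ[X]} {A B : ℤ} (hA : p.coeff 0 = A)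
    (hB : q.coeff 0 = B) (h : LexLT (C (1 / (a : ℚ)) * p) (C (1 / (r : ℚ)) * (q + C d))) :
    LexLE (C (1 / (a : ℚ)) * p) (C (1 / (r : ℚ)) * q) := by
  rcases lexLT_trichotomy (C (1 / (a : ℚ)) * p) (C (1 / (r : ℚ)) * q) with h1 | h1 | h1
  · exact .inl h1
  · exact .inr h1
  exfalso
  have ha' : (0 : ℚ) < a := by exact_mod_cast ha
  have hr1 : (1 : ℚ) ≤ (r : ℚ) - 1 := by
    have : (2 : ℚ) ≤ r := by exact_mod_cast hr
    linarith
  have hr' : (0 : ℚ) < r := by linarith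
  have hd' : d * ((r : ℚ) - 1) < 1 := (lt_div_iff₀ (by linarith)).mp hd
  rw [mul_add, ← C_mul] at h
  obtain ⟨h2, h3⟩ := coeff_zero_lt_of_lexLT h1 h
  rw [coeff_C_mul, coeff_C_mul, hA, hB] at h2 h3
  have h4 : (B : ℚ) * a < A * r := by
    field_simp at h2
    linarith
  have h5 : (A : ℚ) * r < B * a + d * a := by
    field_simp at h3
    linarith
  rcases har.lt_or_eq with h6 | rfl
  · have h7 : (a : ℚ) ≤ (r : ℚ) - 1 := by
      have : (a : ℚ) + 1 ≤ r := by exact_mod_cast h6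
      linarith
    have h8 : d * a < 1 := (mul_le_mul_of_nonneg_left h7 hd0.le).trans_lt hd'
    have h9 : B * a < A * r := by exact_mod_cast h4
    have h10 : (A : ℚ) * r < B * a + 1 := h5.trans (by linarith)
    have h11 : A * r < B * a + 1 := by exact_mod_cast h10
    lia
  -- Here `a ≤ r - 1` fails, but `a` cancels and `r - 1 ≥ 1` gives `d < 1`.
  · have h9 : B < A := by exact_mod_cast lt_of_mul_lt_mul_right h4 ha'.le
    have h8 : d < 1 := by nlinarith
    have h10 : (A : ℚ) < B + 1 := by
      refine lt_of_mul_lt_mul_right (a := (a : ℚ)) ?_ ha'.le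
      nlinarith
    have h11 : A < B + 1 := by exact_mod_cast h10
    lia

/-- The constant term of the Hilbert polynomial is an integer. -/
lemma exists_coeff_zero_sheafHilbertPoly {X : Scheme.{u}} {k : Type u} [Field k]
    (π : X ⟶ Spec (.of k)) (L E : X.Modules) :
    ∃ A : ℤ, (sheafHilbertPoly π L E).coeff 0 = A := by
  unfold sheafHilbertPoly
  split_ifs with h
  -- The constant term is the value at `m = 0`, an Euler characteristic.
  · refine ⟨eulerChar π (twist L E 0), ?_⟩
    rw [coeff_zero_eq_eval_zero]
    simpa using h.choose_spec 0
  · exact ⟨0, by simp⟩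

/-! ### Torsion-free sheaves, generic stalks and rank -/

open Opposite

variable {X : Scheme.{u}}

lemma app_injective_of_mono {F E : X.Modules} (i : F ⟶ E) [Mono i] (U : X.Opens) :
    Function.Injective (i.app U) := by
  have h : Mono ((Scheme.Modules.toPresheaf X).map i) := inferInstance
  have h2 := (NatTrans.mono_iff_mono_app _).mp h (op U)
  exact (AddCommGrpCat.mono_iff_injective _).mp h2

lemma exists_section_ne_zero {F : X.Modules} (hF : ¬ Limits.IsZero F) :
    ∃ (U : X.Opens) (t : Γ(F, U)), t ≠ 0 := by
  by_contra! h
  refine hF ((Limits.IsZero.iff_id_eq_zero F).mpr ?_)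
  ext U t
  exact (h U t).trans (h U _).symm

/-- A section of a quasi-coherent sheaf on `Spec R` that vanishes on `D(f)` is killed by a power
of `f`. -/
lemma exists_pow_smul_eq_zero {R : CommRingCat.{u}} (M : (Spec R).Modules)
    [SheafOfModules.IsQuasicoherent (R := (Spec R).ringCatSheaf) M] (f : R) (t : Γ(M, ⊤))
    (ht : M.presheaf.map (homOfLE le_top : PrimeSpectrum.basicOpen f ⟶ ⊤).op t = 0) :
    ∃ n : ℕ, f ^ n • t = 0 := by
  -- Quasi-coherence makes restriction to `D(f)` the localization at `f`.
  have h := (isIso_fromTildeΓ_iff_isLocalizing M).mp inferInstance f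
  obtain ⟨⟨_, n, rfl⟩, hn⟩ := (IsLocalizedModule.eq_zero_iff (.powers f)
    ((modulesSpecToSheaf.obj M).obj.map (PrimeSpectrum.basicOpen f).leTop.op).hom).mp ht
  exact ⟨n, hn⟩

lemma IsTorsionFree.restrict {Y : Scheme.{u}} {E : X.Modules} (hE : IsTorsionFree E) (f : Y ⟶ X)
    [IsOpenImmersion f] : IsTorsionFree (E.restrict f) := fun U a t ha h ↦
  hE (f ''ᵁ U) ((f.appIso U).inv a) t
    (fun h0 ↦ ha ((f.appIso U).commRingCatIsoToRingEquiv.symm.injective (h0.trans (map_zero _).symm))) h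

/-- A section of a torsion-free quasi-coherent sheaf on the spectrum of a domain is zero if it
vanishes on a nonempty open subset. -/
lemma eq_zero_of_map_eq_zero_of_spec {R : CommRingCat.{u}} [IsDomain R] (M : (Spec R).Modules)
    [SheafOfModules.IsQuasicoherent (R := (Spec R).ringCatSheaf) M] (hM : IsTorsionFree M)
    (t : Γ(M, ⊤)) {V : (Spec R).Opens} {x : Spec R} (hx : x ∈ V)
    (ht : M.presheaf.map (homOfLE le_top : V ⟶ ⊤).op t = 0) : t = 0 := by
  obtain ⟨_, ⟨_, ⟨f, rfl⟩, rfl⟩, hxf, hf : PrimeSpectrum.basicOpen f ≤ _⟩ :=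
    PrimeSpectrum.isBasis_basic_opens.exists_subset_of_mem_open hx V.2
  have hf0 : f ≠ 0 := by
    rintro rfl
    rw [PrimeSpectrum.basicOpen_zero] at hxf
    exact hxf
  obtain ⟨n, hn⟩ := exists_pow_smul_eq_zero M f t (by
    have := congr((M.presheaf.map (homOfLE hf).op).hom $ht).trans (map_zero _)
    rw [← this]
    exact congr($(M.presheaf.map_comp (homOfLE (le_top : V ≤ ⊤)).op (homOfLE hf).op).hom t))
  refine hM ⊤ ((Scheme.ΓSpecIso R).inv (f ^ n)) t (fun h ↦ pow_ne_zero n hf0 ?_) ?_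
  · exact (Scheme.ΓSpecIso R).commRingCatIsoToRingEquiv.symm.injective (h.trans (map_zero _).symm)
  · have e : (Spec R).presheaf.map (TopologicalSpace.Opens.leTop ⊤).op = 𝟙 _ :=
      (Spec R).presheaf.map_id _
    rw [Scheme.Modules.smul_Spec_def, e] at hn
    exact hn

/-- A section of a torsion-free quasi-coherent sheaf on an integral scheme is zero if its germ at
the generic point is zero. -/
lemma eq_zero_of_germ_genericPoint_eq_zero [IsIntegral X] {E : X.Modules}
    (hqc : SheafOfModules.IsQuasicoherent (R := X.ringCatSheaf) E) (hE : IsTorsionFree E)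
    {U : X.Opens} (hU : genericPoint X ∈ U) (t : Γ(E, U))
    (ht : E.presheaf.germ U (genericPoint X) hU t = 0) : t = 0 := by
  obtain ⟨V, hV, j, j', hjt⟩ := E.presheaf.germ_eq _ hU hU t 0 (by rw [ht, map_zero])
  refine TopCat.Presheaf.section_ext ⟨E.presheaf, E.isSheaf⟩ U t 0 fun x hx ↦ ?_
  -- Every nonempty affine chart contains the generic point, hence meets `V`, where `t` vanishes;
  -- this reduces the claim to the affine case.
  obtain ⟨R, f, hf, hxf, hfU⟩ := Scheme.exists_affine_mem_range_and_range_subset hx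
  have hle : f ''ᵁ ⊤ ≤ U := by
    rintro _ ⟨y, -, rfl⟩
    exact hfU ⟨y, rfl⟩
  have hη : genericPoint X ∈ f.opensRange :=
    (genericPoint_spec X).mem_open_set_iff f.opensRange.2 |>.mpr ⟨x, trivial, hxf⟩
  obtain ⟨y, hy⟩ := hη
  have : Nonempty (Spec R) := ⟨y⟩
  have : IsIntegral (Spec R) := isIntegral_of_isOpenImmersion f
  have : IsDomain R := affine_isIntegral_iff R |>.mp this
  have : SheafOfModules.IsQuasicoherent (R := (Spec R).ringCatSheaf) (E.restrict f) :=
    Scheme.Modules.isQuasicoherent_restrictFunctor f E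
  have hyV : y ∈ f ⁻¹ᵁ V := by
    change f y ∈ V
    rwa [hy]
  have h0 : E.presheaf.map (homOfLE hle).op t = 0 := by
    refine eq_zero_of_map_eq_zero_of_spec (E.restrict f) (hE.restrict f) _ hyV ?_
    have h1 : f ''ᵁ f ⁻¹ᵁ V ≤ V := by
      rintro _ ⟨z, hz, rfl⟩
      exact hz
    have h2 := congr(E.presheaf.map (homOfLE h1).op $hjt)
    rw [map_zero, map_zero, ← ConcreteCategory.comp_apply, ← Functor.map_comp] at h2
    change E.presheaf.map _ (E.presheaf.map _ t) = 0
    rw [← ConcreteCategory.comp_apply, ← Functor.map_comp]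
    exact h2
  have hxf' : x ∈ f ''ᵁ ⊤ := by
    obtain ⟨z, rfl⟩ := hxf
    exact ⟨z, trivial, rfl⟩
  rw [map_zero]
  change E.presheaf.germ U x hx t = 0
  rw [← TopCat.Presheaf.germ_res_apply E.presheaf (homOfLE hle) x hxf' t, h0, map_zero]

lemma germ_smul (E : X.Modules) (x : X) (U : X.Opens) (hx : x ∈ U) (a : Γ(X, U)) (t : Γ(E, U)) :
    letI := stalkModule E x
    E.presheaf.germ U x hx (a • t) = X.presheaf.germ U x hx a • E.presheaf.germ U x hx t :=
  PresheafOfModules.germ_smul (R := X.presheaf) E.val x U hx a t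

lemma stalkFunctor_map_germ {F E : X.Modules} (i : F ⟶ E) (x : X) (U : X.Opens) (hx : x ∈ U)
    (t : Γ(F, U)) :
    (TopCat.Presheaf.stalkFunctor Ab x).map i.mapPresheaf (F.presheaf.germ U x hx t) =
      E.presheaf.germ U x hx (i.app U t) :=
  TopCat.Presheaf.stalkFunctor_map_germ_apply U x hx i.mapPresheaf t

/-- The map on stalks of a morphism of sheaves of modules. -/
noncomputable def stalkMap {F E : X.Modules} (i : F ⟶ E) (x : X) :
    letI := stalkModule F x
    letI := stalkModule E x
    F.presheaf.stalk x →ₗ[X.presheaf.stalk x] E.presheaf.stalk x :=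
  letI := stalkModule F x
  letI := stalkModule E x
  { toFun := (TopCat.Presheaf.stalkFunctor Ab x).map i.mapPresheaf
    map_add' := map_add _
    map_smul' a t := by
      obtain ⟨U, hU, a, rfl⟩ := X.presheaf.exists_germ_eq a
      obtain ⟨V, hV, j, t, rfl⟩ := F.presheaf.exists_le_germ_eq t hU
      rw [← TopCat.Presheaf.germ_res_apply X.presheaf (homOfLE hV) x j a]
      refine (congrArg _ (germ_smul F x V j _ t).symm).trans ?_
      refine (stalkFunctor_map_germ i x V j _).trans ?_
      refine (congrArg _ (i.app_smul _ t)).trans ((germ_smul E x V j _ _).trans ?_)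
      exact congrArg _ (stalkFunctor_map_germ i x V j t).symm }

lemma stalkMap_injective {F E : X.Modules} (i : F ⟶ E) [Mono i] (x : X) :
    Function.Injective (stalkMap i x) :=
  TopCat.Presheaf.stalkFunctor_map_injective_of_app_injective (f := i.mapPresheaf)
    (fun U ↦ app_injective_of_mono i U) x

/-- Positivity of `rank E` supplies finite-dimensionality of the generic stalk, as `finrank` is `0`
in infinite dimension. -/
lemma rank_le_of_mono [IsIntegral X] {F E : X.Modules} (i : F ⟶ E) [Mono i] (hE : 0 < rank E) :
    rank F ≤ rank E := by
  let := stalkModule F (genericPoint X)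
  let := stalkModule E (genericPoint X)
  have : Module.Finite X.functionField (E.presheaf.stalk (genericPoint X)) :=
    Module.finite_of_finrank_pos hE
  exact LinearMap.finrank_le_finrank_of_injective (f := stalkMap i (genericPoint X))
    (stalkMap_injective i _)

/-- A nonzero subsheaf of a torsion-free coherent sheaf has positive rank. -/
lemma rank_pos_of_mono [IsIntegral X] {F E : X.Modules} (i : F ⟶ E) [Mono i]
    (hE : IsCoherent E) (htf : IsTorsionFree E) (hrk : 0 < rank E) (hF : ¬ Limits.IsZero F) :
    0 < rank F := by
  let := stalkModule F (genericPoint X)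
  let := stalkModule E (genericPoint X)
  have : Module.Finite X.functionField (E.presheaf.stalk (genericPoint X)) :=
    Module.finite_of_finrank_pos hrk
  have hfin : Module.Finite X.functionField (F.presheaf.stalk (genericPoint X)) :=
    Module.Finite.of_injective (stalkMap i (genericPoint X)) (stalkMap_injective i _)
  obtain ⟨U, t, ht⟩ := exists_section_ne_zero hF
  -- A sheaf has only the zero section over the empty set.
  have hne : (U : Set X).Nonempty := by
    by_contra h
    refine ht (TopCat.Presheaf.section_ext ⟨F.presheaf, F.isSheaf⟩ U t 0 fun x hx ↦ ?_)
    exact absurd ⟨x, hx⟩ h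
  have hη : genericPoint X ∈ U :=
    ((genericPoint_spec X).mem_open_set_iff U.2).mpr (by simpa using hne)
  have hg : F.presheaf.germ U (genericPoint X) hη t ≠ 0 := by
    intro h
    refine ht (app_injective_of_mono i U ?_)
    rw [map_zero]
    refine eq_zero_of_germ_genericPoint_eq_zero hE.quasicoherent htf hη _ ?_
    exact (stalkFunctor_map_germ i _ U hη t).symm.trans
      ((congrArg _ h).trans (map_zero (stalkMap i (genericPoint X))))
  have : Nontrivial (F.presheaf.stalk (genericPoint X)) := ⟨_, _, hg⟩
  exact Module.finrank_pos (R := X.functionField) (M := F.presheaf.stalk (genericPoint X))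

end StablePair

theorem proposition2 {k : Type u} [Field k] [IsAlgClosed k]
    {X : Scheme.{u}} [IsIntegral X] (π : X ⟶ Spec (.of k)) [IsProper π] [Smooth π]
    (L : X.Modules) (hL : StablePair.IsAmple L)
    (E : X.Modules) (hE : StablePair.IsCoherent E) (htf : StablePair.IsTorsionFree E)
    (r : ℕ) (hr : StablePair.rank E = r) (hr2 : 2 ≤ r)
    (h0 : 0 < StablePair.cohomologyDim π E 0)
    (δ : ℚ[X]) (hδpos : 0 < δ.leadingCoeff)
    (hδ : StablePair.LexLT δ (C (1 / ((r : ℚ) - 1))))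
    (s : Γ(E, ⊤)) (hs : StablePair.IsDeltaStable π L δ E s) :
    StablePair.IsSemistable π L E := by
  obtain ⟨d, rfl, hd0, hd⟩ := StablePair.exists_eq_C_of_lexLT hδpos hδ
  refine ⟨hE, hs.pure, fun F i hF hi hF0 hiso ↦ ?_⟩
  have hrk : 0 < StablePair.rank E := by lia
  obtain ⟨A, hA⟩ := StablePair.exists_coeff_zero_sheafHilbertPoly π L F
  obtain ⟨B, hB⟩ := StablePair.exists_coeff_zero_sheafHilbertPoly π L E
  -- The zero section, with scalar `0`, makes any subsheaf a sub-pair with `ε = 0`.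
  have h := hs.lt F i 0 hF hi hF0 hiso ⟨0, by simp⟩
  simp only [StablePair.reducedHilbertPoly, if_true, if_neg hs.section_ne_zero, add_zero, hr] at h
  rw [hr]
  exact StablePair.lexLE_of_lexLT_add (StablePair.rank_pos_of_mono i hE htf hrk hF0)
    (hr ▸ StablePair.rank_le_of_mono i hrk) hr2 hd0 hd hA hB h
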